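/- Let $\xi$ be an (almost surely) positive random variable satisfying \[ \lim_{t\to\infty}\frac{\log \mathbb{P}(\xi\ge t)}{\log t}=-\frac1\beta \] for some $\beta>0$. Let $(A_n)_{n}$ be a sequence of random matrices defined on a common probability space, where, for each $n$, $A_n=(a^{(n)}_{ij})$ is an $n\times n$ matrix whose entries are independent and identically distributed as $\xi$ (no assumption is made on the joint distribution of $A_n$ and $A_m$ for $n\neq m$). Let $\operatorname{perm}A_n=\sum_{\pi\in S_n}\prod_{i=1}^n a^{(n)}_{i,\pi(i)}$ be the permanent. Then almost surely \[ \lim_{n\to\infty}\frac{\log \operatorname{perm}A_n}{n\log n}=\max(1,\beta). \] Moreover, $\mathbb{E}\,\xi<\infty$ if $\beta<1$ and $\mathbb{E}\,\xi=\infty$ if $\beta>1$, and the limit has a first-order phase transition at $\beta=1$: the function $b\mapsto\max(1,b)$ has left derivative $0$ and right derivative $1$ at $b=1$. -/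

import Mathlib

open MeasureTheory ProbabilityTheory Filter Topology

/-! The logarithm of the permanent is squeezed between `a n log n` and `b n log n` for all
`a < max 1 β < b`, each time by a summable failure probability and the Borel-Cantelli lemma, so that
nothing is needed about the joint law of the matrices.

*Upper bound.* For `0 < s ≤ 1` the power `x ↦ x ^ s` is subadditive, so `E (perm A) ^ s` is at most
`n! (E ξ ^ s) ^ n`, and `E ξ ^ s` is finite for `s < 1 / β`. Markov's inequality with `s` slightly
below `min 1 (1 / β)` bounds the permanent by `n ^ (b n)`
(`lintegral_permanent_rpow_le`, `ae_eventually_le_of_max_lt`).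

*Lower bound.* Both halves rest on `RobustHall`, a version of Hall's condition that survives the
removal of `d` rows and columns. If it holds for the entries `≥ c`, then rows can be matched one by
one with at least `d, d - 1, …, 1` choices before Hall's theorem completes the matching, whence
`d! c ^ n ≤ perm A` (`RobustHall.factorial_mul_pow_le_permanent`). The condition fails only if
some large rectangle has all its entries `< c`, and a rectangle of sides `s`, `t` does so with
probability `P (ξ < c) ^ (s t)`; a union bound over rectangles remains. With `d = ⌊θ n⌋`, `θ < 1`,
and `c` a small constant this gives the exponent `θ` (the number of permutations counts,
`ae_eventually_le_of_lt_one`); with `d = 0` and `c = n ^ b`, `b < β`, it gives the exponent `b` (a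
single permutation of large entries counts, `ae_eventually_le_of_lt_tail_exponent`). -/

/-! ### Counting perfect matchings -/

/-- The relation `r` on a finite type has an edge in every nonempty rectangle `S ×ˢ T` with
`#S + #T ≥ card ι + 1 - d`. For `d = 0` this is Hall's condition for a perfect matching; in general
it says that Hall's condition survives the removal of any `d` rows and `d` columns. -/
def RobustHall {ι : Type*} [Fintype ι] (r : ι → ι → Prop) (d : ℕ) : Prop :=
  ∀ S T : Finset ι, S.Nonempty → T.Nonempty → Fintype.card ι + 1 ≤ S.card + T.card + d →
    ∃ i ∈ S, ∃ j ∈ T, r i j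

namespace RobustHall

variable {ι : Type*} [Fintype ι] {r : ι → ι → Prop} {d : ℕ}

/-- A partial matching of at most `d` rows extends to a perfect matching. -/
theorem exists_perm_extending (h : RobustHall r d) {R : Finset ι} (hR : R.card ≤ d)
    {F : ι → ι} (hF : Set.InjOn F R) (hFr : ∀ i ∈ R, r i (F i)) :
    ∃ σ : Equiv.Perm ι, (∀ i, r i (σ i)) ∧ ∀ i ∈ R, σ i = F i := by
  classical
  let t : ι → Finset ι := fun i =>
    if i ∈ R then {F i} else Finset.univ.filter fun j => r i j ∧ j ∉ R.image F
  have hall : ∀ s : Finset ι, s.card ≤ (s.biUnion t).card := by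
    intro s
    set s₁ := s.filter (· ∈ R)
    set s₂ := s.filter (· ∉ R)
    set N := s₂.biUnion t
    have hs : s₁.card + s₂.card = s.card := Finset.card_filter_add_card_filter_not _
    have hsub : s₁.image F ∪ N ⊆ s.biUnion t := by
      intro j hj
      rcases Finset.mem_union.1 hj with hj | hj
      · obtain ⟨i, hi, rfl⟩ := Finset.mem_image.1 hj
        obtain ⟨his, hiR⟩ := Finset.mem_filter.1 hi
        exact Finset.mem_biUnion.2 ⟨i, his, by simp [t, hiR]⟩
      · obtain ⟨i, hi, hij⟩ := Finset.mem_biUnion.1 hj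
        exact Finset.mem_biUnion.2 ⟨i, (Finset.mem_filter.1 hi).1, hij⟩
    have hNR : ∀ j ∈ N, j ∉ R.image F := by
      intro j hj
      obtain ⟨i, hi, hij⟩ := Finset.mem_biUnion.1 hj
      have hiR := (Finset.mem_filter.1 hi).2
      simp only [t, hiR, if_false, Finset.mem_filter] at hij
      exact hij.2.2
    have hdisj : Disjoint (s₁.image F) N := by
      rw [Finset.disjoint_left]
      intro j hj hjN
      exact hNR j hjN (Finset.image_subset_image (fun i hi => (Finset.mem_filter.1 hi).2) hj)
    have hs₁ : (s₁.image F).card = s₁.card :=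
      Finset.card_image_of_injOn (hF.mono fun i hi => (Finset.mem_filter.1 hi).2)
    have hcard := Finset.card_le_card hsub
    rw [Finset.card_union_of_disjoint hdisj, hs₁] at hcard
    suffices s₂.card ≤ N.card by omega
    by_contra! hlt
    -- The columns that are neither used by `F` nor adjacent to `s₂` form an empty rectangle.
    set T := (R.image F ∪ N)ᶜ
    have hT : T.card + (R.card + N.card) = Fintype.card ι := by
      rw [← Finset.card_image_of_injOn hF, ← Finset.card_union_of_disjoint, add_comm]
      · exact Finset.card_add_card_compl _
      · rw [Finset.disjoint_right]; exact hNR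
    have hRs : R.card + s₂.card ≤ Fintype.card ι := by
      rw [← Finset.card_union_of_disjoint]
      · exact Finset.card_le_univ _
      · rw [Finset.disjoint_right]; exact fun i hi => (Finset.mem_filter.1 hi).2
    obtain ⟨i, hi, j, hj, hij⟩ := h s₂ T (Finset.card_pos.1 (by omega))
      (Finset.card_pos.1 (by omega)) (by omega)
    rw [Finset.mem_compl, Finset.mem_union, not_or] at hj
    refine hj.2 (Finset.mem_biUnion.2 ⟨i, hi, ?_⟩)
    simp only [t, (Finset.mem_filter.1 hi).2, if_false, Finset.mem_filter]
    exact ⟨Finset.mem_univ _, hij, hj.1⟩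
  obtain ⟨f, hf, hft⟩ := (Finset.all_card_le_biUnion_card_iff_exists_injective t).1 hall
  have hfR : ∀ i ∈ R, f i = F i := fun i hi => by simpa [t, hi] using hft i
  refine ⟨Equiv.ofBijective f (Finite.injective_iff_bijective.1 hf), fun i => ?_, hfR⟩
  rw [Equiv.ofBijective_apply]
  by_cases hi : i ∈ R
  · rw [hfR i hi]; exact hFr i hi
  · have := hft i
    simp only [t, hi, if_false, Finset.mem_filter] at this
    exact this.2.1

/-- A free row has at least `k + 1` free neighbours as long as `#R + k + 1 ≤ d` rows are spoken
for, whence the factorial. -/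
theorem factorial_le_card_extending [DecidableEq ι] [DecidableRel r] (h : RobustHall r d)
    (hd : d ≤ Fintype.card ι) (k : ℕ) :
    ∀ (R : Finset ι), R.card + k ≤ d → ∀ F : ι → ι, Set.InjOn F R → (∀ i ∈ R, r i (F i)) →
      k.factorial ≤ (Finset.univ.filter fun σ : Equiv.Perm ι =>
        (∀ i, r i (σ i)) ∧ ∀ i ∈ R, σ i = F i).card := by
  induction k with
  | zero =>
    intro R hR F hF hFr
    obtain ⟨σ, hσ⟩ := h.exists_perm_extending (by omega) hF hFr
    rw [Nat.factorial_zero, Nat.succ_le_iff, Finset.card_pos]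
    exact ⟨σ, by simpa using hσ⟩
  | succ k ih =>
    intro R hR F hF hFr
    obtain ⟨i₀, hi₀⟩ : ∃ i₀, i₀ ∉ R := by
      by_contra! hall
      have : R = Finset.univ := Finset.eq_univ_iff_forall.2 hall
      rw [this, Finset.card_univ] at hR
      omega
    set J := Finset.univ.filter fun j => r i₀ j ∧ j ∉ R.image F
    have hJ : k + 1 ≤ J.card := by
      by_contra! hlt
      have hT : (R.image F ∪ J)ᶜ.card + (R.card + J.card) = Fintype.card ι := by
        rw [← Finset.card_image_of_injOn hF, ← Finset.card_union_of_disjoint, add_comm]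
        · exact Finset.card_add_card_compl _
        · rw [Finset.disjoint_right]; exact fun j hj => (Finset.mem_filter.1 hj).2.2
      obtain ⟨i, hi, j, hj, hij⟩ := h {i₀} (R.image F ∪ J)ᶜ (Finset.singleton_nonempty _)
        (Finset.card_pos.1 (by omega)) (by rw [Finset.card_singleton]; omega)
      rw [Finset.mem_compl, Finset.mem_union, not_or] at hj
      rw [Finset.mem_singleton] at hi
      subst hi
      exact hj.2 (Finset.mem_filter.2 ⟨Finset.mem_univ _, hij, hj.1⟩)
    have hne : ∀ i ∈ R, i ≠ i₀ := fun i hi h' => hi₀ (h' ▸ hi)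
    set B : ι → Finset (Equiv.Perm ι) := fun j => Finset.univ.filter fun σ : Equiv.Perm ι =>
      (∀ i, r i (σ i)) ∧ ∀ i ∈ insert i₀ R, σ i = Function.update F i₀ j i
    have hB : ∀ j ∈ J, k.factorial ≤ (B j).card := by
      intro j hj
      obtain ⟨hjr, hjF⟩ := (Finset.mem_filter.1 hj).2
      refine ih (insert i₀ R) (by rw [Finset.card_insert_of_notMem hi₀]; omega) _ ?_ ?_
      · rw [Finset.coe_insert, Set.injOn_insert (by simpa using hi₀)]
        refine ⟨fun a ha b hb hab => ?_, ?_⟩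
        · rw [Function.update_of_ne (hne a ha), Function.update_of_ne (hne b hb)] at hab
          exact hF ha hb hab
        · rintro ⟨a, ha, hab⟩
          rw [Function.update_of_ne (hne a ha), Function.update_self] at hab
          exact hjF (Finset.mem_image.2 ⟨a, ha, hab⟩)
      · intro i hi
        rcases Finset.mem_insert.1 hi with rfl | hi
        · simpa using hjr
        · rw [Function.update_of_ne (hne i hi)]; exact hFr i hi
    have hdisj : Set.PairwiseDisjoint (J : Set ι) B := by
      intro a _ b _ hab
      rw [Function.onFun, Finset.disjoint_left]
      intro σ ha hb
      have h₁ := (Finset.mem_filter.1 ha).2.2 i₀ (Finset.mem_insert_self _ _)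
      have h₂ := (Finset.mem_filter.1 hb).2.2 i₀ (Finset.mem_insert_self _ _)
      rw [Function.update_self] at h₁ h₂
      exact hab (h₁.symm.trans h₂)
    calc (k + 1).factorial = (k + 1) * k.factorial := Nat.factorial_succ k
      _ ≤ J.card * k.factorial := Nat.mul_le_mul_right _ hJ
      _ ≤ ∑ j ∈ J, (B j).card := by
        rw [← smul_eq_mul]; exact Finset.card_nsmul_le_sum _ _ _ hB
      _ = (J.biUnion B).card := (Finset.card_biUnion hdisj).symm
      _ ≤ _ := by
        refine Finset.card_le_card fun σ hσ => ?_
        obtain ⟨j, _, hj⟩ := Finset.mem_biUnion.1 hσ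
        obtain ⟨hσr, hσF⟩ := (Finset.mem_filter.1 hj).2
        refine Finset.mem_filter.2 ⟨Finset.mem_univ _, hσr, fun i hi => ?_⟩
        rw [hσF i (Finset.mem_insert_of_mem hi), Function.update_of_ne (hne i hi)]

theorem factorial_mul_pow_le_permanent [DecidableEq ι] {M : Matrix ι ι ℝ} (hM : ∀ i j, 0 ≤ M i j)
    {c : ℝ} (hc : 0 ≤ c) (h : RobustHall (fun i j => c ≤ M j i) d) (hd : d ≤ Fintype.card ι) :
    d.factorial * c ^ Fintype.card ι ≤ M.permanent := by
  classical
  have hcard := h.factorial_le_card_extending hd d ∅ (by simp) id (by simp) (by simp)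
  set G := Finset.univ.filter fun σ : Equiv.Perm ι =>
    (∀ i, c ≤ M (σ i) i) ∧ ∀ i ∈ (∅ : Finset ι), σ i = id i
  calc (d.factorial : ℝ) * c ^ Fintype.card ι ≤ G.card * c ^ Fintype.card ι := by gcongr
    _ = ∑ σ ∈ G, ∏ _i : ι, c := by simp
    _ ≤ ∑ σ ∈ G, ∏ i, M (σ i) i := by
      refine Finset.sum_le_sum fun σ hσ => Finset.prod_le_prod (fun _ _ => hc) fun i _ => ?_
      exact (Finset.mem_filter.1 hσ).2.1 i
    _ ≤ M.permanent :=
      Finset.sum_le_sum_of_subset_of_nonneg (Finset.subset_univ _)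
        fun σ _ _ => Finset.prod_nonneg fun i _ => hM _ _

end RobustHall

/-! ### Union bounds over empty rectangles -/

theorem RobustHall.measureReal_not_le_sum {Ω ι : Type*} [MeasurableSpace Ω] {μ : Measure Ω}
    [IsProbabilityMeasure μ] [Fintype ι] [DecidableEq ι] {X : ι × ι → Ω → ℝ} (hX : iIndepFun X μ)
    {c q : ℝ} (hq : ∀ p, μ.real {ω | X p ω < c} ≤ q) (d : ℕ) :
    μ.real {ω | ¬ RobustHall (fun i j => c ≤ X (j, i) ω) d} ≤
      ∑ x : Finset ι × Finset ι with x.1.Nonempty ∧ x.2.Nonempty ∧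
        Fintype.card ι + 1 ≤ x.1.card + x.2.card + d, q ^ (x.1.card * x.2.card) := by
  set I := Finset.univ.filter fun x : Finset ι × Finset ι => x.1.Nonempty ∧ x.2.Nonempty ∧
        Fintype.card ι + 1 ≤ x.1.card + x.2.card + d
  have hsub : {ω | ¬ RobustHall (fun i j => c ≤ X (j, i) ω) d} ⊆
      ⋃ x ∈ I, ⋂ p ∈ x.2 ×ˢ x.1, X p ⁻¹' Set.Iio c := by
    intro ω hω
    simp only [RobustHall, Set.mem_ofPred_eq, not_forall, not_exists, not_and, not_le] at hω
    obtain ⟨S, T, hS, hT, hST, h⟩ := hω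
    refine Set.mem_biUnion (show (S, T) ∈ I from
      Finset.mem_filter.2 ⟨Finset.mem_univ _, hS, hT, hST⟩) ?_
    simp only [Set.mem_iInter, Finset.mem_product]
    exact fun p hp => h p.2 hp.2 p.1 hp.1
  refine (measureReal_mono hsub (measure_ne_top _ _)).trans ((measureReal_biUnion_finset_le _ _).trans ?_)
  refine Finset.sum_le_sum fun x _ => ?_
  rw [measureReal_def, hX.measure_inter_preimage_eq_mul _ (sets := fun _ => Set.Iio c)
    (fun _ _ => measurableSet_Iio), ENNReal.toReal_prod]
  refine (Finset.prod_le_prod (fun _ _ => ENNReal.toReal_nonneg) fun p _ => hq p).trans ?_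
  rw [Finset.prod_const, Finset.card_product, mul_comm]

/-- Every rectangle in the union bound has at least `n - d` cells, and there are at most `4 ^ n`
rectangles. -/
theorem sum_pow_rectangle_le_four_pow {ι : Type*} [Fintype ι] {q : ℝ} (hq : 0 ≤ q) (hq1 : q ≤ 1)
    (d : ℕ) :
    ∑ x : Finset ι × Finset ι with x.1.Nonempty ∧ x.2.Nonempty ∧
        Fintype.card ι + 1 ≤ x.1.card + x.2.card + d, q ^ (x.1.card * x.2.card) ≤
      4 ^ Fintype.card ι * q ^ (Fintype.card ι - d) := by
  refine (Finset.sum_le_card_nsmul _ _ (q ^ (Fintype.card ι - d)) fun x hx => ?_).trans ?_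
  · obtain ⟨h₁, h₂, h₃⟩ := (Finset.mem_filter.1 hx).2
    refine pow_le_pow_of_le_one hq hq1 ?_
    have h₁ := Finset.card_pos.2 h₁
    have h₂ := Finset.card_pos.2 h₂
    obtain ⟨a, ha⟩ := Nat.exists_eq_add_of_le' h₁
    obtain ⟨b, hb⟩ := Nat.exists_eq_add_of_le' h₂
    have hab : x.1.card * x.2.card = a * b + a + b + 1 := by rw [ha, hb]; ring
    have := Nat.zero_le (a * b)
    omega
  · rw [nsmul_eq_mul]
    refine mul_le_mul_of_nonneg_right ?_ (pow_nonneg hq _)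
    have : (Finset.univ.filter fun x : Finset ι × Finset ι => x.1.Nonempty ∧ x.2.Nonempty ∧
        Fintype.card ι + 1 ≤ x.1.card + x.2.card + d).card ≤ 4 ^ Fintype.card ι := by
      refine (Finset.card_filter_le _ _).trans (le_of_eq ?_)
      rw [Finset.card_univ, Fintype.card_prod, Fintype.card_finset, ← mul_pow]
      norm_num
    exact_mod_cast this

theorem sum_pow_card_nonempty {ι : Type*} [Fintype ι] [DecidableEq ι] (x : ℝ) :
    ∑ S : Finset ι with S.Nonempty, x ^ S.card = (1 + x) ^ Fintype.card ι - 1 := by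
  have h := Fintype.sum_pow_mul_eq_add_pow ι x 1
  simp only [one_pow, mul_one] at h
  rw [add_comm 1 x, ← h, ← Finset.sum_filter_add_sum_filter_not Finset.univ
    (fun S : Finset ι => S.Nonempty)]
  have : (Finset.univ.filter fun S : Finset ι => ¬ S.Nonempty) = {∅} := by
    ext S; simp [Finset.not_nonempty_iff_eq_empty]
  rw [this, Finset.sum_singleton, Finset.card_empty, pow_zero, add_sub_cancel_right]

/-- In the rectangles of Hall's condition the longer side `T` has at least half of the lines and its
complement has fewer lines than the shorter side `S`, so that the term is at most
`x ^ (#S + #Tᶜ)`, and the sum over `S` and `Tᶜ` factorizes. -/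
theorem sum_pow_hall_rectangle_le {ι : Type*} [Fintype ι] [DecidableEq ι] {q x : ℝ} (hq : 0 ≤ q)
    (hq1 : q ≤ 1) (hx : 0 ≤ x) (hx1 : x ≤ 1) (hqx : q ^ Fintype.card ι ≤ x ^ 4) :
    ∑ y : Finset ι × Finset ι with y.1.Nonempty ∧ y.2.Nonempty ∧
        Fintype.card ι + 1 ≤ y.1.card + y.2.card + 0, q ^ (y.1.card * y.2.card) ≤
      2 * (((1 + x) ^ Fintype.card ι - 1) * (1 + x) ^ Fintype.card ι) := by
  have key : ∀ S T : Finset ι, S.card ≤ T.card → Fintype.card ι + 1 ≤ S.card + T.card →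
      q ^ (S.card * T.card) ≤ x ^ S.card * x ^ Tᶜ.card := by
    intro S T hle hST
    have hT := Finset.card_compl_add_card T
    have h₁ : q ^ T.card ≤ x ^ 2 := by
      refine (pow_le_pow_iff_left₀ (by positivity) (by positivity) two_ne_zero).1 ?_
      calc (q ^ T.card) ^ 2 = q ^ (T.card * 2) := (pow_mul _ _ _).symm
        _ ≤ q ^ Fintype.card ι := pow_le_pow_of_le_one hq hq1 (by omega)
        _ ≤ (x ^ 2) ^ 2 := by rw [← pow_mul]; exact hqx
    calc q ^ (S.card * T.card) = (q ^ T.card) ^ S.card := by rw [mul_comm, pow_mul]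
      _ ≤ (x ^ 2) ^ S.card := pow_le_pow_left₀ (by positivity) h₁ _
      _ = x ^ (2 * S.card) := (pow_mul _ _ _).symm
      _ ≤ x ^ (S.card + Tᶜ.card) := pow_le_pow_of_le_one hx hx1 (by omega)
      _ = _ := pow_add _ _ _
  have hall : ∑ T : Finset ι, x ^ Tᶜ.card = (1 + x) ^ Fintype.card ι := by
    rw [← (Equiv.ofBijective _ (compl_bijective (α := Finset ι))).sum_comp
      (fun T : Finset ι => x ^ Tᶜ.card)]
    have h := Fintype.sum_pow_mul_eq_add_pow ι x 1
    simp only [one_pow, mul_one] at h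
    simp [h, add_comm]
  have hsum : ∑ y ∈ (Finset.univ.filter fun S : Finset ι => S.Nonempty) ×ˢ
      (Finset.univ : Finset (Finset ι)), x ^ y.1.card * x ^ y.2ᶜ.card =
      ((1 + x) ^ Fintype.card ι - 1) * (1 + x) ^ Fintype.card ι := by
    rw [Finset.sum_product, ← sum_pow_card_nonempty, ← hall, Finset.sum_mul_sum]
  set I := (Finset.univ.filter fun S : Finset ι => S.Nonempty) ×ˢ
      (Finset.univ : Finset (Finset ι))
  set I' := (Finset.univ : Finset (Finset ι)) ×ˢ
    (Finset.univ.filter fun S : Finset ι => S.Nonempty)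
  have hsum' : ∑ y ∈ I', x ^ y.2.card * x ^ y.1ᶜ.card =
      ((1 + x) ^ Fintype.card ι - 1) * (1 + x) ^ Fintype.card ι := by
    rw [← hsum, Finset.sum_product, Finset.sum_product_right]
  set K := Finset.univ.filter fun y : Finset ι × Finset ι => y.1.Nonempty ∧ y.2.Nonempty ∧
        Fintype.card ι + 1 ≤ y.1.card + y.2.card + 0
  rw [← Finset.sum_filter_add_sum_filter_not K (fun y => y.1.card ≤ y.2.card), two_mul]
  refine add_le_add ?_ ?_
  · rw [← hsum]
    refine (Finset.sum_le_sum (g := fun y => x ^ y.1.card * x ^ y.2ᶜ.card) fun y hy => ?_).trans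
      (Finset.sum_le_sum_of_subset_of_nonneg (fun y hy => ?_) fun _ _ _ => by positivity)
    · obtain ⟨hy, hle⟩ := Finset.mem_filter.1 hy
      exact key _ _ hle (Finset.mem_filter.1 hy).2.2.2
    · have hy := (Finset.mem_filter.1 (Finset.mem_filter.1 hy).1).2
      simp [I, hy.1]
  · rw [← hsum']
    refine (Finset.sum_le_sum (g := fun y => x ^ y.2.card * x ^ y.1ᶜ.card) fun y hy => ?_).trans
      (Finset.sum_le_sum_of_subset_of_nonneg (fun y hy => ?_) fun _ _ _ => by positivity)
    · obtain ⟨hy, hle⟩ := Finset.mem_filter.1 hy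
      have := (Finset.mem_filter.1 hy).2.2.2
      rw [mul_comm]
      exact key _ _ (by omega) (by omega)
    · have hy := (Finset.mem_filter.1 (Finset.mem_filter.1 hy).1).2
      simp [I', hy.2.1]

theorem ae_eventually_notMem_of_eventually_measureReal_le {Ω : Type*} [MeasurableSpace Ω]
    {μ : Measure Ω} [IsFiniteMeasure μ] {s : ℕ → Set Ω} {f : ℕ → ℝ} (hf : Summable f)
    (h : ∀ᶠ n in atTop, μ.real (s n) ≤ f n) : ∀ᵐ ω ∂μ, ∀ᶠ n in atTop, ω ∉ s n := by
  have hs : Summable fun n => μ.real (s n) :=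
    Summable.of_norm_bounded_eventually_nat hf <| h.mono fun n hn => by
      rwa [Real.norm_of_nonneg measureReal_nonneg]
  refine ae_eventually_notMem ?_
  have := hs.tsum_ofReal_ne_top
  simpa using this

/-! ### Tail and moments of the entries -/

section Tail

variable {Ω : Type*} [MeasurableSpace Ω] {P : Measure Ω} {ξ : Ω → ℝ} {β r : ℝ}

theorem eventually_tail_le
    (htail : Tendsto (fun t : ℝ => Real.log (P.real {ω | t ≤ ξ ω}) / Real.log t)
      atTop (𝓝 (-(1 / β)))) (hr : r < 1 / β) :
    ∀ᶠ t : ℝ in atTop, P.real {ω | t ≤ ξ ω} ≤ t ^ (-r) := by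
  filter_upwards [htail.eventually_lt_const (neg_lt_neg hr), eventually_gt_atTop 1] with t ht ht1
  rw [div_lt_iff₀ (Real.log_pos ht1)] at ht
  rcases (measureReal_nonneg (μ := P) (s := {ω | t ≤ ξ ω})).eq_or_lt with h0 | h0
  · rw [← h0]; positivity
  · rw [Real.rpow_def_of_pos (by linarith), ← Real.log_le_iff_le_exp h0]
    linarith

/-- The hypothesis `0 < β` rules out a vanishing tail, for which `Real.log 0 = 0` would make the
limit `0`. -/
theorem eventually_le_tail (hβ : 0 < β)
    (htail : Tendsto (fun t : ℝ => Real.log (P.real {ω | t ≤ ξ ω}) / Real.log t)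
      atTop (𝓝 (-(1 / β)))) (hr : 1 / β < r) :
    ∀ᶠ t : ℝ in atTop, t ^ (-r) ≤ P.real {ω | t ≤ ξ ω} := by
  have hneg : -(1 / β) < 0 := neg_neg_of_pos (by positivity)
  filter_upwards [htail.eventually_const_lt (neg_lt_neg hr), htail.eventually_lt_const hneg,
    eventually_gt_atTop 1] with t ht ht0 ht1
  rw [lt_div_iff₀ (Real.log_pos ht1)] at ht
  rcases (measureReal_nonneg (μ := P) (s := {ω | t ≤ ξ ω})).eq_or_lt with h0 | h0
  · rw [← h0, Real.log_zero, zero_div] at ht0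
    exact absurd ht0 (lt_irrefl _)
  · rw [Real.rpow_def_of_pos (by linarith), ← Real.le_log_iff_exp_le h0]
    linarith

theorem lintegral_rpow_lt_top_of_tail [IsProbabilityMeasure P] (hξm : AEMeasurable ξ P)
    (hξpos : ∀ᵐ ω ∂P, 0 < ξ ω)
    (htail : Tendsto (fun t : ℝ => Real.log (P.real {ω | t ≤ ξ ω}) / Real.log t)
      atTop (𝓝 (-(1 / β)))) {s : ℝ} (hs : 0 < s) (hsβ : s < 1 / β) :
    ∫⁻ ω, ENNReal.ofReal (ξ ω ^ s) ∂P < ⊤ := by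
  obtain ⟨r, hsr, hrβ⟩ := exists_between hsβ
  rw [lintegral_eq_lintegral_meas_le P (hξpos.mono fun ω h => by
    show 0 ≤ ξ ω ^ s; positivity) (hξm.pow_const s)]
  have hev := (tendsto_rpow_atTop (inv_pos.2 hs)).eventually (eventually_tail_le htail hrβ)
  obtain ⟨t₀, ht₀⟩ := eventually_atTop.1 (hev.and (eventually_gt_atTop 0))
  have ht₀pos : 0 < t₀ := (ht₀ t₀ le_rfl).2
  rw [← Set.Ioc_union_Ioi_eq_Ioi ht₀pos.le]
  refine (lintegral_union_le _ _ _).trans_lt (ENNReal.add_lt_top.2 ⟨?_, ?_⟩)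
  · calc ∫⁻ t in Set.Ioc 0 t₀, P {ω | t ≤ ξ ω ^ s} ≤ ∫⁻ t in Set.Ioc 0 t₀, 1 :=
          lintegral_mono fun t => prob_le_one
      _ < ⊤ := by simp
  · have hint : IntegrableOn (fun t : ℝ => t ^ (-(r / s))) (Set.Ioi t₀) :=
      integrableOn_Ioi_rpow_of_lt (neg_lt_neg ((one_lt_div hs).2 hsr)) ht₀pos
    refine lt_of_le_of_lt (setLIntegral_mono' measurableSet_Ioi fun t ht => ?_)
      hint.lintegral_lt_top
    obtain ⟨h, htpos⟩ := ht₀ t (le_of_lt ht)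
    calc P {ω | t ≤ ξ ω ^ s} ≤ P {ω | t ^ s⁻¹ ≤ ξ ω} := by
          refine measure_mono_ae ?_
          filter_upwards [hξpos] with ω hω h'
          exact (Real.rpow_inv_le_iff_of_pos htpos.le hω.le hs).2 h'
      _ = ENNReal.ofReal (P.real {ω | t ^ s⁻¹ ≤ ξ ω}) := by simp
      _ ≤ ENNReal.ofReal (t ^ (-(r / s))) := by
          refine ENNReal.ofReal_le_ofReal (h.trans (le_of_eq ?_))
          rw [← Real.rpow_mul htpos.le]
          congr 1
          field_simp

/-- Markov's inequality bounds `t * P (t ≤ ξ)`, which is unbounded, by the mean. -/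
theorem lintegral_eq_top_of_tail [IsFiniteMeasure P] (hξm : AEMeasurable ξ P) (hβ : 1 < β)
    (htail : Tendsto (fun t : ℝ => Real.log (P.real {ω | t ≤ ξ ω}) / Real.log t)
      atTop (𝓝 (-(1 / β)))) :
    ∫⁻ ω, ENNReal.ofReal (ξ ω) ∂P = ⊤ := by
  obtain ⟨r, hr, hr1⟩ := exists_between ((div_lt_one (by linarith)).2 hβ)
  have hlim : Tendsto (fun t : ℝ => ENNReal.ofReal (t ^ (1 - r))) atTop (𝓝 ⊤) :=
    ENNReal.tendsto_ofReal_nhds_top.2 (tendsto_rpow_atTop (by linarith))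
  refine top_le_iff.1 (le_of_tendsto hlim ?_)
  filter_upwards [eventually_le_tail (by linarith) htail hr, eventually_gt_atTop 0] with t ht ht0
  calc ENNReal.ofReal (t ^ (1 - r)) ≤ ENNReal.ofReal (t * P.real {ω | t ≤ ξ ω}) := by
        refine ENNReal.ofReal_le_ofReal ?_
        rw [sub_eq_add_neg, Real.rpow_add ht0, Real.rpow_one]
        gcongr
    _ = ENNReal.ofReal t * P {ω | t ≤ ξ ω} := by rw [ENNReal.ofReal_mul ht0.le]; simp
    _ ≤ ENNReal.ofReal t * P {ω | ENNReal.ofReal t ≤ ENNReal.ofReal (ξ ω)} := by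
        exact mul_le_mul' le_rfl (measure_mono fun ω h => ENNReal.ofReal_le_ofReal h)
    _ ≤ _ := mul_meas_ge_le_lintegral₀ hξm.ennreal_ofReal _

end Tail

/-! ### Quantitative estimates -/

theorem Matrix.permanent_pos_of_entries_pos {ι : Type*} [Fintype ι] [DecidableEq ι]
    {M : Matrix ι ι ℝ} (hM : ∀ i j, 0 < M i j) : 0 < M.permanent :=
  Finset.sum_pos (fun _ _ => Finset.prod_pos fun _ _ => hM _ _) Finset.univ_nonempty

theorem exists_pos_measureReal_lt_le {Ω : Type*} [MeasurableSpace Ω] {P : Measure Ω}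
    [IsFiniteMeasure P] {ξ : Ω → ℝ} (hξm : AEMeasurable ξ P) (hξpos : ∀ᵐ ω ∂P, 0 < ξ ω)
    {q : ℝ} (hq : 0 < q) : ∃ δ > 0, P.real {ω | ξ ω < δ} ≤ q := by
  have hinter : P (⋂ k : ℕ, {ω | ξ ω < 1 / ((k : ℝ) + 1)}) = 0 := by
    refine measure_mono_null (fun ω hω => ?_) (ae_iff.1 hξpos)
    refine fun hpos : 0 < ξ ω => ?_
    obtain ⟨k, hk⟩ := exists_nat_one_div_lt hpos
    exact lt_asymm hk (Set.mem_iInter.1 hω k)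
  have hlim := tendsto_measure_iInter_atTop (μ := P)
    (s := fun k : ℕ => {ω | ξ ω < 1 / ((k : ℝ) + 1)})
    (fun k => nullMeasurableSet_lt hξm aemeasurable_const)
    (fun k l hkl ω (hω : ξ ω < _) => hω.trans_le (Nat.one_div_le_one_div hkl))
    ⟨0, measure_ne_top _ _⟩
  rw [hinter] at hlim
  obtain ⟨k, hk⟩ := (hlim.eventually_lt_const (ENNReal.ofReal_pos.2 hq)).exists
  exact ⟨1 / ((k : ℝ) + 1), Nat.one_div_pos_of_nat, ENNReal.toReal_le_of_le_ofReal hq.le hk.le⟩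

theorem mul_log_sub_le_log_factorial (d : ℕ) :
    d * Real.log d - d ≤ Real.log d.factorial := by
  rcases Nat.eq_zero_or_pos d with rfl | hd
  · simp
  have hd' : (0 : ℝ) < d := by exact_mod_cast hd
  have h := Real.log_le_log (by positivity)
    (Real.pow_div_factorial_le_exp _ (Nat.cast_nonneg (α := ℝ) d) d)
  rw [Real.log_exp, Real.log_div (by positivity) (by positivity), Real.log_pow] at h
  linarith

/-- Since `log d! = d log d + O(d)`, the left side is asymptotically smaller by the factor
`a / θ < 1`. -/
theorem eventually_mul_log_le_log_factorial_floor {a θ : ℝ} (haθ : a < θ) (hθ : 0 < θ) (y : ℝ) :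
    ∀ᶠ n : ℕ in atTop, a * ((n : ℝ) * Real.log n) ≤
      Real.log (⌊θ * n⌋₊.factorial : ℝ) + n * y := by
  have hlog : Tendsto (fun n : ℕ => Real.log (n : ℝ)) atTop atTop :=
    Real.tendsto_log_atTop.comp tendsto_natCast_atTop_atTop
  have hρ : Tendsto (fun n : ℕ => (⌊θ * n⌋₊ : ℝ) / n) atTop (𝓝 θ) :=
    (tendsto_nat_floor_mul_div_atTop hθ.le).comp tendsto_natCast_atTop_atTop
  have hlim : Tendsto (fun n : ℕ => (⌊θ * n⌋₊ : ℝ) / n * (Real.log ((⌊θ * n⌋₊ : ℝ) / n) /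
      Real.log n + 1) - (⌊θ * n⌋₊ : ℝ) / n / Real.log n + y / Real.log n) atTop (𝓝 θ) := by
    have h := ((hρ.mul (((hρ.log hθ.ne').div_atTop hlog).add_const 1)).sub
      (hρ.div_atTop hlog)).add ((tendsto_const_nhds (x := y)).div_atTop hlog)
    simpa using h
  filter_upwards [hlim.eventually_const_lt haθ, hρ.eventually_const_lt hθ,
    eventually_gt_atTop 1] with n hn hρn hn1
  have hn1' : (1 : ℝ) < n := by exact_mod_cast hn1
  have hn0 : (0 : ℝ) < n := by linarith
  have hl := Real.log_pos hn1'
  have hd0 : (0 : ℝ) < ⌊θ * n⌋₊ := by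
    rcases (Nat.cast_nonneg (α := ℝ) ⌊θ * n⌋₊).eq_or_lt with h | h
    · rw [← h, zero_div] at hρn; exact absurd hρn (lt_irrefl _)
    · exact h
  rw [Real.log_div hd0.ne' hn0.ne'] at hn
  refine le_trans ?_ (add_le_add_left (mul_log_sub_le_log_factorial _) _)
  have heq : (⌊θ * n⌋₊ : ℝ) * Real.log ⌊θ * n⌋₊ - ⌊θ * n⌋₊ + n * y =
      ((⌊θ * n⌋₊ : ℝ) / n * ((Real.log (⌊θ * n⌋₊ : ℝ) - Real.log n) /
      Real.log n + 1) - (⌊θ * n⌋₊ : ℝ) / n / Real.log n + y / Real.log n) *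
      ((n : ℝ) * Real.log n) := by
    field_simp
    ring
  rw [heq]
  gcongr

/-- The union bound for Hall's condition is at most `12 n x`, where `x = exp (-n ^ γ / 4)` decays
faster than every power of `n`. -/
theorem summable_hall_bound {γ : ℝ} (hγ : 0 < γ) :
    Summable fun n : ℕ => 2 * (((1 + Real.exp (-(n : ℝ) ^ γ / 4)) ^ n - 1) *
      (1 + Real.exp (-(n : ℝ) ^ γ / 4)) ^ n) := by
  have hO := (isLittleO_exp_neg_mul_rpow_atTop (show (0 : ℝ) < 1 / 4 by norm_num)
    (-3 / γ)).comp_tendsto ((tendsto_rpow_atTop hγ).comp (tendsto_natCast_atTop_atTop (R := ℝ)))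
  have hO' := hO.bound one_pos
  have hs : Summable fun n : ℕ => 12 * (n : ℝ) ^ (-2 : ℝ) :=
    (Real.summable_nat_rpow.2 (by norm_num)).mul_left _
  refine Summable.of_norm_bounded_eventually_nat hs ?_
  filter_upwards [hO', eventually_ge_atTop 1] with n hn hn1
  have hn1' : (1 : ℝ) ≤ n := by exact_mod_cast hn1
  have hn0 : (0 : ℝ) < n := by linarith
  set x := Real.exp (-(n : ℝ) ^ γ / 4) with hx
  have hx0 : 0 < x := Real.exp_pos _
  have hxle : x ≤ (n : ℝ) ^ (-3 : ℝ) := by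
    simp only [Function.comp_apply, Real.norm_eq_abs, one_mul, Real.abs_exp] at hn
    rw [abs_of_nonneg (by positivity), ← Real.rpow_mul hn0.le] at hn
    convert hn using 2 <;> field_simp
  have hnx : n * x ≤ (n : ℝ) ^ (-2 : ℝ) := by
    calc n * x ≤ n * (n : ℝ) ^ (-3 : ℝ) := by gcongr
      _ = (n : ℝ) ^ (-2 : ℝ) := by
        rw [← Real.rpow_one_add' hn0.le (by norm_num)]; norm_num
  have hnx1 : n * x ≤ 1 := hnx.trans (Real.rpow_le_one_of_one_le_of_nonpos hn1' (by norm_num))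
  have hpow : (1 + x) ^ n ≤ Real.exp (n * x) := by
    rw [Real.exp_nat_mul]
    exact pow_le_pow_left₀ (by positivity) (by rw [add_comm]; exact Real.add_one_le_exp x) n
  have h1 : 1 ≤ (1 + x) ^ n := one_le_pow₀ (by linarith)
  have hexp : Real.exp (n * x) - 1 ≤ 2 * (n * x) := by
    have h := Real.abs_exp_sub_one_le (x := n * x) (by rwa [abs_of_nonneg (by positivity)])
    rw [abs_of_nonneg (a := (n : ℝ) * x) (by positivity)] at h
    exact (le_abs_self _).trans h
  rw [Real.norm_of_nonneg (mul_nonneg zero_le_two (mul_nonneg (by linarith) (by linarith)))]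
  calc 2 * (((1 + x) ^ n - 1) * (1 + x) ^ n) ≤ 2 * ((2 * (n * x)) * 3) := by
        gcongr
        · linarith
        · linarith
    _ = 12 * (n * x) := by ring
    _ ≤ _ := by gcongr

/-! ### Fractional moments of the permanent -/

theorem Finset.sum_rpow_le_sum_rpow_of_le_one {κ : Type*} (s : Finset κ) {f : κ → ℝ}
    (hf : ∀ i, 0 ≤ f i) {p : ℝ} (hp : 0 < p) (hp1 : p ≤ 1) : (∑ i ∈ s, f i) ^ p ≤ ∑ i ∈ s, f i ^ p := by
  classical
  induction s using Finset.induction_on with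
  | empty => simp [Real.zero_rpow hp.ne']
  | insert i s hi ih =>
    rw [Finset.sum_insert hi, Finset.sum_insert hi]
    exact (Real.rpow_add_le_add_rpow (hf i) (Finset.sum_nonneg fun j _ => hf j) hp.le hp1).trans
      (by gcongr)

theorem ProbabilityTheory.iIndepFun.lintegral_prod_of_aemeasurable {Ω ι : Type*}
    [MeasurableSpace Ω] {μ : Measure Ω} [Fintype ι] {X : ι → Ω → ENNReal} (hX : iIndepFun X μ)
    (hm : ∀ i, AEMeasurable (X i) μ) : ∫⁻ ω, ∏ i, X i ω ∂μ = ∏ i, ∫⁻ ω, X i ω ∂μ := by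
  rw [Finset.prod_congr rfl fun i _ => lintegral_congr_ae (hm i).ae_eq_mk,
    ← lintegral_prod_eq_prod_lintegral_of_indepFun Finset.univ _
      (hX.congr fun i => (hm i).ae_eq_mk) fun i => (hm i).measurable_mk]
  refine lintegral_congr_ae ?_
  filter_upwards [ae_all_iff.2 fun i => (hm i).ae_eq_mk] with ω hω
  exact Finset.prod_congr rfl fun i _ => hω i

/-- Subadditivity of `x ↦ x ^ s` for `s ≤ 1` replaces the permanent, whose mean may be infinite, by
a sum of `n!` products of independent variables with finite mean. -/
theorem lintegral_permanent_rpow_le {Ω ι : Type*} [MeasurableSpace Ω] {μ : Measure Ω}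
    [IsProbabilityMeasure μ] [Fintype ι] [DecidableEq ι] {A : Ω → Matrix ι ι ℝ}
    (hindep : iIndepFun (fun (p : ι × ι) (ω : Ω) => A ω p.1 p.2) μ)
    (hm : ∀ i j, AEMeasurable (fun ω => A ω i j) μ) (hpos : ∀ᵐ ω ∂μ, ∀ i j, 0 < A ω i j)
    {s : ℝ} (hs : 0 < s) (hs1 : s ≤ 1) {C : ENNReal}
    (hC : ∀ i j, ∫⁻ ω, ENNReal.ofReal (A ω i j ^ s) ∂μ = C) :
    ∫⁻ ω, ENNReal.ofReal ((A ω).permanent ^ s) ∂μ ≤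
      (Fintype.card ι).factorial * C ^ Fintype.card ι := by
  have hms : ∀ i j, AEMeasurable (fun ω => ENNReal.ofReal (A ω i j ^ s)) μ :=
    fun i j => ((hm i j).pow_const s).ennreal_ofReal
  calc ∫⁻ ω, ENNReal.ofReal ((A ω).permanent ^ s) ∂μ
      ≤ ∫⁻ ω, ∑ σ : Equiv.Perm ι, ∏ i, ENNReal.ofReal (A ω (σ i) i ^ s) ∂μ := by
        refine lintegral_mono_ae ?_
        filter_upwards [hpos] with ω hω
        have hnn : ∀ i j, 0 ≤ A ω i j ^ s := fun i j => Real.rpow_nonneg (hω i j).le s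
        simp_rw [← ENNReal.ofReal_prod_of_nonneg fun i _ => hnn _ i]
        rw [← ENNReal.ofReal_sum_of_nonneg fun σ _ => Finset.prod_nonneg fun i _ => hnn _ _]
        refine ENNReal.ofReal_le_ofReal ((Finset.sum_rpow_le_sum_rpow_of_le_one _
          (fun σ => Finset.prod_nonneg fun i _ => (hω _ _).le) hs hs1).trans (le_of_eq ?_))
        exact Finset.sum_congr rfl fun σ _ =>
          (Real.finsetProd_rpow _ _ (fun i _ => (hω _ _).le) s).symm
    _ = ∑ σ : Equiv.Perm ι, ∫⁻ ω, ∏ i, ENNReal.ofReal (A ω (σ i) i ^ s) ∂μ :=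
        lintegral_finsetSum' _ fun σ _ => Finset.aemeasurable_fun_prod _ fun i _ => hms _ _
    _ = ∑ σ : Equiv.Perm ι, C ^ Fintype.card ι := by
        refine Finset.sum_congr rfl fun σ _ => ?_
        have hσ : iIndepFun (fun i ω => ENNReal.ofReal (A ω (σ i) i ^ s)) μ :=
          (hindep.precomp (g := fun i => (σ i, i)) fun i j h => congrArg Prod.snd h).comp
            (fun _ x => ENNReal.ofReal (x ^ s)) fun _ => by fun_prop
        rw [hσ.lintegral_prod_of_aemeasurable fun i => hms _ _]
        simp [hC]
    _ = _ := by simp [Fintype.card_perm]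

/-! ### Almost sure bounds for the permanent -/

section RandomPermanent

variable {Ω' : Type*} [MeasurableSpace Ω'] {P : Measure Ω'} {ξ : Ω' → ℝ}
  {Ω : Type*} [MeasurableSpace Ω] {μ : Measure Ω}
  {A : (n : ℕ) → Ω → Matrix (Fin n) (Fin n) ℝ}

theorem ae_entries_pos (hξpos : ∀ᵐ ω ∂P, 0 < ξ ω)
    (hident : ∀ (n : ℕ) (i j : Fin n), IdentDistrib (fun ω => A n ω i j) ξ μ P) :
    ∀ᵐ ω ∂μ, ∀ (n : ℕ) (i j : Fin n), 0 < A n ω i j := by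
  simp_rw [ae_all_iff]
  exact fun n i j => (hident n i j).symm.ae_mem_snd measurableSet_Ioi hξpos

theorem measureReal_entry_lt
    (hident : ∀ (n : ℕ) (i j : Fin n), IdentDistrib (fun ω => A n ω i j) ξ μ P) (c : ℝ) {n : ℕ}
    (p : Fin n × Fin n) : μ.real {ω | A n ω p.1 p.2 < c} = P.real {ω | ξ ω < c} :=
  congrArg ENNReal.toReal ((hident n p.1 p.2).measure_mem_eq measurableSet_Iio)

variable [IsProbabilityMeasure μ]

/-- A robust matching condition that almost surely holds eventually yields a lower bound for the
permanents. -/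
theorem ae_eventually_le_log_permanent_of_robustHall (hξpos : ∀ᵐ ω ∂P, 0 < ξ ω)
    (hident : ∀ (n : ℕ) (i j : Fin n), IdentDistrib (fun ω => A n ω i j) ξ μ P)
    {c : ℕ → ℝ} (hc : ∀ᶠ n in atTop, 0 < c n) {d : ℕ → ℕ} (hd : ∀ n, d n ≤ n)
    {a : ℝ} (ha : ∀ᶠ n : ℕ in atTop, a * ((n : ℝ) * Real.log n) ≤
      Real.log ((d n).factorial : ℝ) + n * Real.log (c n))
    {f : ℕ → ℝ} (hf : Summable f)
    (hfail : ∀ᶠ n in atTop,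
      μ.real {ω | ¬ RobustHall (fun i j => c n ≤ A n ω j i) (d n)} ≤ f n) :
    ∀ᵐ ω ∂μ, ∀ᶠ n : ℕ in atTop,
      a ≤ Real.log (A n ω).permanent / ((n : ℝ) * Real.log (n : ℝ)) := by
  filter_upwards [ae_entries_pos hξpos hident,
    ae_eventually_notMem_of_eventually_measureReal_le hf hfail] with ω hpos hω
  filter_upwards [hω, hc, ha, eventually_gt_atTop 1] with n hn hcn han hn1
  have hn1' : (1 : ℝ) < n := by exact_mod_cast hn1
  rw [le_div_iff₀ (mul_pos (by linarith) (Real.log_pos hn1'))]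
  have hper := RobustHall.factorial_mul_pow_le_permanent (M := A n ω)
    (fun i j => (hpos n i j).le) hcn.le (not_not.1 hn) (by simpa using hd n)
  rw [Fintype.card_fin] at hper
  have hlog := Real.log_le_log (by positivity) hper
  rw [Real.log_mul (by positivity) (by positivity), Real.log_pow] at hlog
  exact han.trans hlog

variable [IsProbabilityMeasure P]

/-- The robustness `d = ⌊θ n⌋` for `θ < 1` costs only a failure probability `2 ^ (-n)` at a low
enough constant threshold, and gives `log d! ≈ θ n log n`. -/
theorem ae_eventually_le_of_lt_one (hξm : AEMeasurable ξ P) (hξpos : ∀ᵐ ω ∂P, 0 < ξ ω)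
    (hindep : ∀ n : ℕ, iIndepFun (fun (p : Fin n × Fin n) (ω : Ω) => A n ω p.1 p.2) μ)
    (hident : ∀ (n : ℕ) (i j : Fin n), IdentDistrib (fun ω => A n ω i j) ξ μ P)
    {a : ℝ} (ha : a < 1) :
    ∀ᵐ ω ∂μ, ∀ᶠ n : ℕ in atTop,
      a ≤ Real.log (A n ω).permanent / ((n : ℝ) * Real.log (n : ℝ)) := by
  obtain ⟨θ, hθ, hθ1⟩ := exists_between (max_lt ha zero_lt_one)
  obtain ⟨haθ, hθ0⟩ := max_lt_iff.1 hθ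
  have hη : 0 < 1 - θ := by linarith
  -- `q ^ (1 - θ) = 1 / 8` beats the number `4 ^ n` of rectangles.
  set q : ℝ := (1 / 8) ^ (1 / (1 - θ)) with hq
  have hq0 : 0 < q := by positivity
  have hq1 : q ≤ 1 := Real.rpow_le_one (by norm_num) (by norm_num) (by positivity)
  obtain ⟨δ, hδ, hPδ⟩ := exists_pos_measureReal_lt_le hξm hξpos hq0
  refine ae_eventually_le_log_permanent_of_robustHall hξpos hident (c := fun _ => δ)
    (d := fun n => ⌊θ * n⌋₊) (Eventually.of_forall fun _ => hδ) (fun n => ?_)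
    (eventually_mul_log_le_log_factorial_floor haθ hθ0 _)
    (summable_geometric_of_lt_one (r := 1 / 2) (by norm_num) (by norm_num))
    (Eventually.of_forall fun n => ?_)
  · exact Nat.floor_le_of_le (mul_le_of_le_one_left (Nat.cast_nonneg n) hθ1.le)
  · refine (RobustHall.measureReal_not_le_sum (hindep n)
      (fun p => (measureReal_entry_lt hident δ p).trans_le hPδ) _).trans
      ((sum_pow_rectangle_le_four_pow hq0.le hq1 _).trans ?_)
    rw [Fintype.card_fin]
    have hfl : (⌊θ * n⌋₊ : ℝ) ≤ θ * n := Nat.floor_le (by positivity)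
    have hle : ⌊θ * n⌋₊ ≤ n :=
      Nat.floor_le_of_le (mul_le_of_le_one_left (Nat.cast_nonneg n) hθ1.le)
    have hqn : q ^ (n - ⌊θ * n⌋₊) ≤ (1 / 8) ^ n := by
      rw [← Real.rpow_natCast, ← Real.rpow_natCast, Nat.cast_sub hle, hq,
        ← Real.rpow_mul (by norm_num)]
      refine Real.rpow_le_rpow_of_exponent_ge (by norm_num) (by norm_num) ?_
      rw [div_mul_eq_mul_div, one_mul, le_div_iff₀ hη]
      linarith
    calc (4 : ℝ) ^ n * q ^ (n - ⌊θ * n⌋₊) ≤ 4 ^ n * (1 / 8) ^ n := by gcongr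
      _ = (1 / 2) ^ n := by rw [← mul_pow]; norm_num

/-- Entries above the threshold `n ^ b` have probability `n ^ (-b r)` with `b r < 1`, which leaves
about `n ^ (1 - b r)` of them in each line: enough for a perfect matching among them. -/
theorem ae_eventually_le_of_lt_tail_exponent {β : ℝ} (hβ : 0 < β) (hξm : AEMeasurable ξ P)
    (hξpos : ∀ᵐ ω ∂P, 0 < ξ ω)
    (htail : Tendsto (fun t : ℝ => Real.log (P.real {ω | t ≤ ξ ω}) / Real.log t)
      atTop (𝓝 (-(1 / β))))
    (hindep : ∀ n : ℕ, iIndepFun (fun (p : Fin n × Fin n) (ω : Ω) => A n ω p.1 p.2) μ)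
    (hident : ∀ (n : ℕ) (i j : Fin n), IdentDistrib (fun ω => A n ω i j) ξ μ P)
    {b : ℝ} (hb : 0 < b) (hbβ : b < β) :
    ∀ᵐ ω ∂μ, ∀ᶠ n : ℕ in atTop,
      b ≤ Real.log (A n ω).permanent / ((n : ℝ) * Real.log (n : ℝ)) := by
  obtain ⟨r, hr, hrb⟩ := exists_between (one_div_lt_one_div_of_lt hb hbβ)
  have hr0 : 0 < r := lt_trans (by positivity) hr
  have hγ : 0 < 1 - b * r := by rw [lt_div_iff₀ hb] at hrb; linarith
  have hev := ((tendsto_rpow_atTop hb).comp (tendsto_natCast_atTop_atTop (R := ℝ))).eventually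
    (eventually_le_tail hβ htail hr)
  refine ae_eventually_le_log_permanent_of_robustHall hξpos hident (c := fun n => (n : ℝ) ^ b)
    (d := fun _ => 0) ?_ (fun n => Nat.zero_le n) ?_ (summable_hall_bound hγ) ?_
  · filter_upwards [eventually_gt_atTop 0] with n hn
    have : (0 : ℝ) < n := by exact_mod_cast hn
    positivity
  · filter_upwards [eventually_gt_atTop 0] with n hn
    have : (0 : ℝ) < n := by exact_mod_cast hn
    rw [Real.log_rpow this, Nat.factorial_zero, Nat.cast_one, Real.log_one, zero_add]
    exact le_of_eq (by ring)
  · filter_upwards [hev, eventually_ge_atTop 1] with n hn hn1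
    have hn1' : (1 : ℝ) ≤ n := by exact_mod_cast hn1
    have hn0 : (0 : ℝ) < n := by linarith
    simp only [Function.comp_apply] at hn
    rw [← Real.rpow_mul hn0.le] at hn
    set u := (n : ℝ) ^ (b * -r) with hu
    have hu0 : 0 < u := by positivity
    have hu1 : u ≤ 1 := Real.rpow_le_one_of_one_le_of_nonpos hn1' (by nlinarith)
    have hPc : P.real {ω | ξ ω < (n : ℝ) ^ b} ≤ 1 - u := by
      have hnull : NullMeasurableSet {ω | (n : ℝ) ^ b ≤ ξ ω} P :=
        nullMeasurableSet_le aemeasurable_const hξm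
      have h := probReal_compl_eq_one_sub₀ hnull
      have hcompl : {ω | (n : ℝ) ^ b ≤ ξ ω}ᶜ = {ω | ξ ω < (n : ℝ) ^ b} := by
        ext ω; simp
      rw [hcompl] at h
      linarith
    have h := (RobustHall.measureReal_not_le_sum (hindep n)
      (fun p => (measureReal_entry_lt hident _ p).trans_le hPc) 0).trans
      (sum_pow_hall_rectangle_le (x := Real.exp (-(n : ℝ) ^ (1 - b * r) / 4)) (by linarith)
        (by linarith) (Real.exp_nonneg _) (Real.exp_le_one_iff.2 ?_) ?_)
    · rwa [Fintype.card_fin] at h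
    · have : 0 < (n : ℝ) ^ (1 - b * r) := by positivity
      linarith
    · rw [Fintype.card_fin, ← Real.exp_nat_mul]
      calc (1 - u) ^ n ≤ Real.exp (-u) ^ n :=
            pow_le_pow_left₀ (by linarith) (Real.one_sub_le_exp_neg u) n
        _ = Real.exp (n * -u) := (Real.exp_nat_mul _ _).symm
        _ = _ := by
          congr 1
          have : (n : ℝ) ^ (1 - b * r) = n * u := by
            rw [hu, sub_eq_add_neg, Real.rpow_add hn0, Real.rpow_one, mul_neg]
          rw [this]
          push_cast
          ring

/-- Markov's inequality for the `s`-th power of the permanent, where `1 / b < s < min 1 (1 / β)`: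
the bound `n! C ^ n / n ^ (b s n)` is summable because `1 < b s`. -/
theorem ae_eventually_le_of_max_lt {β : ℝ} (hβ : 0 < β) (hξm : AEMeasurable ξ P)
    (hξpos : ∀ᵐ ω ∂P, 0 < ξ ω)
    (htail : Tendsto (fun t : ℝ => Real.log (P.real {ω | t ≤ ξ ω}) / Real.log t)
      atTop (𝓝 (-(1 / β))))
    (hindep : ∀ n : ℕ, iIndepFun (fun (p : Fin n × Fin n) (ω : Ω) => A n ω p.1 p.2) μ)
    (hident : ∀ (n : ℕ) (i j : Fin n), IdentDistrib (fun ω => A n ω i j) ξ μ P)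
    {b : ℝ} (hb : max 1 β < b) :
    ∀ᵐ ω ∂μ, ∀ᶠ n : ℕ in atTop,
      Real.log (A n ω).permanent / ((n : ℝ) * Real.log (n : ℝ)) ≤ b := by
  obtain ⟨hb1, hbβ⟩ := max_lt_iff.1 hb
  have hb0 : 0 < b := by linarith
  obtain ⟨s, hbs, hs⟩ := exists_between
    (lt_min ((div_lt_one hb0).2 hb1) (one_div_lt_one_div_of_lt hβ hbβ))
  obtain ⟨hs1, hsβ⟩ := lt_min_iff.1 hs
  have hs0 : 0 < s := lt_trans (by positivity) hbs
  have hγ : 0 < b * s - 1 := by rw [div_lt_iff₀ hb0] at hbs; linarith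
  have hpos := ae_entries_pos hξpos hident
  set C := ∫⁻ ω, ENNReal.ofReal (ξ ω ^ s) ∂P
  have hC : C < ⊤ := lintegral_rpow_lt_top_of_tail hξm hξpos htail hs0 hsβ
  have hsmall : Tendsto (fun n : ℕ => C.toReal * (n : ℝ) ^ (-(b * s - 1))) atTop (𝓝 0) := by
    have h := ((tendsto_rpow_neg_atTop hγ).comp
      (tendsto_natCast_atTop_atTop (R := ℝ))).const_mul C.toReal
    rwa [mul_zero] at h
  have hbad : ∀ᶠ n : ℕ in atTop,
      μ.real {ω | ((n : ℝ) ^ (b * n)) ^ s ≤ (A n ω).permanent ^ s} ≤ (1 / 2) ^ n := by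
    filter_upwards [hsmall.eventually_le_const (show (0 : ℝ) < 1 / 2 by norm_num),
      eventually_gt_atTop 0] with n hn hn0
    have hn0' : (0 : ℝ) < n := by exact_mod_cast hn0
    have hm : ∀ i j, AEMeasurable (fun ω => A n ω i j) μ :=
      fun i j => (hident n i j).aemeasurable_fst
    have hmean := lintegral_permanent_rpow_le (hindep n) hm (hpos.mono fun ω h => h n) hs0 hs1.le
      (C := C) fun i j => ((hident n i j).comp
        (u := fun x : ℝ => ENNReal.ofReal (x ^ s)) (by fun_prop)).lintegral_eq
    have hmper : AEMeasurable (fun ω => (A n ω).permanent) μ :=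
      Finset.aemeasurable_fun_sum _ fun σ _ => Finset.aemeasurable_fun_prod _ fun i _ => hm _ _
    have hmarkov := (mul_meas_ge_le_lintegral₀ (hmper.pow_const s).ennreal_ofReal
      (ENNReal.ofReal (((n : ℝ) ^ (b * n)) ^ s))).trans hmean
    rw [Fintype.card_fin] at hmarkov
    set t := ((n : ℝ) ^ (b * n)) ^ s with ht
    have ht0 : 0 < t := by positivity
    have hreal : t * μ.real {ω | t ≤ (A n ω).permanent ^ s} ≤ n.factorial * C.toReal ^ n := by
      have hle : ENNReal.ofReal t * μ {ω | t ≤ (A n ω).permanent ^ s} ≤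
          n.factorial * C ^ n :=
        (mul_le_mul' le_rfl
          (measure_mono fun ω h => ENNReal.ofReal_le_ofReal h)).trans hmarkov
      have h := ENNReal.toReal_mono
        (ENNReal.mul_ne_top (ENNReal.natCast_ne_top _) (ENNReal.pow_ne_top hC.ne)) hle
      simpa [measureReal_def, ENNReal.toReal_ofReal ht0.le] using h
    have hfac : (n.factorial : ℝ) ≤ (n : ℝ) ^ n := by exact_mod_cast Nat.factorial_le_pow n
    have heq : (n : ℝ) ^ n * C.toReal ^ n = t * (C.toReal * (n : ℝ) ^ (-(b * s - 1))) ^ n := by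
      have htn : t = ((n : ℝ) ^ (b * s)) ^ n := by
        rw [ht, ← Real.rpow_mul hn0'.le, ← Real.rpow_natCast, ← Real.rpow_mul hn0'.le]
        ring_nf
      rw [htn, ← mul_pow, ← mul_pow]
      congr 1
      have : (n : ℝ) ^ (b * s) * (n : ℝ) ^ (-(b * s - 1)) = n := by
        rw [← Real.rpow_add hn0']; simp
      linear_combination (-C.toReal) * this
    refine le_of_mul_le_mul_left ?_ ht0
    calc t * μ.real {ω | t ≤ (A n ω).permanent ^ s} ≤ n.factorial * C.toReal ^ n := hreal
      _ ≤ (n : ℝ) ^ n * C.toReal ^ n := by gcongr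
      _ = t * (C.toReal * (n : ℝ) ^ (-(b * s - 1))) ^ n := heq
      _ ≤ t * (1 / 2) ^ n := by gcongr
  filter_upwards [hpos, ae_eventually_notMem_of_eventually_measureReal_le
    (summable_geometric_of_lt_one (r := 1 / 2) (by norm_num) (by norm_num)) hbad] with ω hω hev
  filter_upwards [hev, eventually_gt_atTop 1] with n hn hn1
  have hn1' : (1 : ℝ) < n := by exact_mod_cast hn1
  have hn0 : (0 : ℝ) < n := by linarith
  have hper := Matrix.permanent_pos_of_entries_pos (hω n)
  have hlt : (A n ω).permanent ≤ (n : ℝ) ^ (b * n) := by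
    by_contra! hlt
    exact hn (Real.rpow_le_rpow (by positivity) hlt.le hs0.le)
  rw [div_le_iff₀ (mul_pos hn0 (Real.log_pos hn1')), ← mul_assoc, ← Real.log_rpow hn0]
  exact Real.log_le_log hper hlt

end RandomPermanent

/-- Countably many levels `a` suffice. -/
theorem ae_tendsto_of_ae_eventually_le {Ω : Type*} [MeasurableSpace Ω] {μ : Measure Ω}
    {L : ℕ → Ω → ℝ} {l : ℝ} (hlow : ∀ a < l, ∀ᵐ ω ∂μ, ∀ᶠ n in atTop, a ≤ L n ω)
    (hup : ∀ b > l, ∀ᵐ ω ∂μ, ∀ᶠ n in atTop, L n ω ≤ b) :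
    ∀ᵐ ω ∂μ, Tendsto (fun n => L n ω) atTop (𝓝 l) := by
  have hlow' : ∀ᵐ ω ∂μ, ∀ a : ℚ, (a : ℝ) < l → ∀ᶠ n in atTop, (a : ℝ) ≤ L n ω :=
    ae_all_iff.2 fun a => by
      by_cases h : (a : ℝ) < l
      · exact (hlow a h).mono fun ω hω _ => hω
      · exact Eventually.of_forall fun ω h' => absurd h' h
  have hup' : ∀ᵐ ω ∂μ, ∀ b : ℚ, l < (b : ℝ) → ∀ᶠ n in atTop, L n ω ≤ (b : ℝ) :=
    ae_all_iff.2 fun b => by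
      by_cases h : l < (b : ℝ)
      · exact (hup b h).mono fun ω hω _ => hω
      · exact Eventually.of_forall fun ω h' => absurd h' h
  filter_upwards [hlow', hup'] with ω h₁ h₂
  refine tendsto_order.2 ⟨fun a ha => ?_, fun b hb => ?_⟩
  · obtain ⟨c, hac, hcl⟩ := exists_rat_btwn ha
    exact (h₁ c hcl).mono fun n hn => hac.trans_le hn
  · obtain ⟨c, hlc, hcb⟩ := exists_rat_btwn hb
    exact (h₂ c hlc).mono fun n hn => hn.trans_lt hcb

theorem theorem1
    {Ω' : Type*} [MeasurableSpace Ω'] (P : Measure Ω') [IsProbabilityMeasure P]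
    (ξ : Ω' → ℝ) (hξm : AEMeasurable ξ P) (hξpos : ∀ᵐ ω ∂P, 0 < ξ ω)
    (β : ℝ) (hβ : 0 < β)
    (htail : Tendsto (fun t : ℝ => Real.log (P.real {ω | t ≤ ξ ω}) / Real.log t)
      atTop (𝓝 (-(1 / β))))
    {Ω : Type*} [MeasurableSpace Ω] (μ : Measure Ω) [IsProbabilityMeasure μ]
    (A : (n : ℕ) → Ω → Matrix (Fin n) (Fin n) ℝ)
    (hindep : ∀ n : ℕ, iIndepFun (fun (p : Fin n × Fin n) (ω : Ω) => A n ω p.1 p.2) μ)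
    (hident : ∀ (n : ℕ) (i j : Fin n), IdentDistrib (fun ω => A n ω i j) ξ μ P) :
    -- the strong law for the logarithm of the permanent
    (∀ᵐ ω ∂μ, Tendsto
      (fun n : ℕ => Real.log (A n ω).permanent / ((n : ℝ) * Real.log (n : ℝ)))
      atTop (𝓝 (max 1 β))) ∧
    -- the mean of `ξ` is finite below `β = 1` and infinite above
    (β < 1 → ∫⁻ ω, ENNReal.ofReal (ξ ω) ∂P < ⊤) ∧
    (1 < β → ∫⁻ ω, ENNReal.ofReal (ξ ω) ∂P = ⊤) ∧
    -- the limit, as a function of the tail parameter, has a jump of its first derivative at `1`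
    HasDerivWithinAt (fun b : ℝ => max 1 b) 0 (Set.Iic 1) 1 ∧
    HasDerivWithinAt (fun b : ℝ => max 1 b) 1 (Set.Ici 1) 1 := by
  refine ⟨ae_tendsto_of_ae_eventually_le (fun a ha => ?_) fun b hb =>
    ae_eventually_le_of_max_lt hβ hξm hξpos htail hindep hident hb, fun hβ1 => ?_,
    fun hβ1 => lintegral_eq_top_of_tail hξm hβ1 htail, ?_, ?_⟩
  · rcases lt_max_iff.1 ha with ha | ha
    · exact ae_eventually_le_of_lt_one hξm hξpos hindep hident ha
    · -- The level is raised to a positive one.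
      refine (ae_eventually_le_of_lt_tail_exponent hβ hξm hξpos htail hindep hident
        (b := max a (β / 2)) (lt_max_of_lt_right (by linarith))
        (max_lt ha (by linarith))).mono fun ω hω => ?_
      exact hω.mono fun n hn => (le_max_left _ _).trans hn
  · simpa using lintegral_rpow_lt_top_of_tail hξm hξpos htail one_pos ((one_lt_div hβ).2 hβ1)
  · exact (hasDerivWithinAt_const (1 : ℝ) (Set.Iic 1) (1 : ℝ)).congr_of_mem
      (fun b hb => max_eq_left hb) Set.self_mem_Iic
  · exact (hasDerivWithinAt_id (1 : ℝ) (Set.Ici 1)).congr_of_mem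
      (fun b hb => max_eq_right hb) Set.self_mem_Ici
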